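/- Theorem 1.2. Let $\mathcal{H}$ be a separable, infinite-dimensional complex Hilbert space, and let $B(\mathcal{H})$ be the algebra of all bounded linear operators on $\mathcal{H}$. Let $C$ be a conjugation on $\mathcal{H}$, that is, a conjugate-linear map $C:\mathcal{H}\to\mathcal{H}$ such that $C^2=\mathrm{Id}$ and $\langle Cx,Cy\rangle=\langle y,x\rangle$ for all $x,y\in\mathcal{H}$. Let $\mathcal{O}_C=\{T\in B(\mathcal{H}): CTC=-T^*\}$, a complex Lie algebra under the bracket $[X,Y]=XY-YX$, and let $\mathcal{L}\subseteq\mathcal{O}_C$ be a subset. Then $\mathcal{L}$ is a Lie ideal of $\mathcal{O}_C$ (that is, a complex-linear subspace of $\mathcal{O}_C$, not assumed closed in any topology, such that $[A,X]\in\mathcal{L}$ for all $A\in\mathcal{O}_C$ and $X\in\mathcal{L}$) if and only if there exists a two-sided ideal $\mathcal{I}$ of the associative algebra $B(\mathcal{H})$ (not assumed closed) such that $\mathcal{L}=\mathcal{I}\cap\mathcal{O}_C$. -/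

import Mathlib

open scoped InnerProductSpace

attribute [local instance] LieRing.ofAssociativeRing

/-- A conjugation on a complex inner product space: a conjugate-linear map `C` with `C⁻¹ = C`
and `⟪C x, C y⟫ = ⟪y, x⟫` for all `x, y`. -/
structure Conjugation (H : Type*) [NormedAddCommGroup H] [InnerProductSpace ℂ H] where
  /-- The underlying conjugate-linear map. -/
  toMap : H →ₗ⋆[ℂ] H
  involutive' : ∀ x, toMap (toMap x) = x
  inner_map_map' : ∀ x y, ⟪toMap x, toMap y⟫_ℂ = ⟪y, x⟫_ℂ

namespace Conjugation

variable {H : Type*} [NormedAddCommGroup H] [InnerProductSpace ℂ H]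

instance : CoeFun (Conjugation H) (fun _ => H → H) := ⟨fun C => C.toMap⟩

variable [CompleteSpace H]

/-- The orthogonal Lie algebra `O_C` of a conjugation `C`: the complex Lie algebra of all bounded
operators `T` on `H` with `C T C = -T*`, under the commutator bracket `[X, Y] = X Y - Y X`. -/
def orthogonalLieAlgebra (C : Conjugation H) : LieSubalgebra ℂ (H →L[ℂ] H) where
  carrier := {T | ∀ x, C (T (C x)) = -(ContinuousLinearMap.adjoint T) x}
  zero_mem' := by intro x; simp
  add_mem' := by
    intro S T hS hT x
    simp only [Set.mem_ofPred_eq] at hS hT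
    simp only [add_apply, map_add, hS, hT]
    abel
  smul_mem' := by
    intro c T hT x
    simp only [Set.mem_ofPred_eq] at hT
    have hc : ContinuousLinearMap.adjoint (c • T) =
        starRingEnd ℂ c • ContinuousLinearMap.adjoint T :=
      map_smulₛₗ ContinuousLinearMap.adjoint c T
    simp [hT, hc]
  lie_mem' := by
    intro S T hS hT x
    have hS' : ∀ x, C (S (C x)) = -(ContinuousLinearMap.adjoint S) x := hS
    have hT' : ∀ x, C (T (C x)) = -(ContinuousLinearMap.adjoint T) x := hT
    have key : ∀ A B : H →L[ℂ] H, C (A (B (C x))) = C (A (C (C (B (C x))))) := by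
      intro A B
      rw [C.involutive' (B (C x))]
    have hadj : ∀ A B : H →L[ℂ] H, ContinuousLinearMap.adjoint (A * B) =
        ContinuousLinearMap.adjoint B * ContinuousLinearMap.adjoint A :=
      fun A B => ContinuousLinearMap.adjoint_comp A B
    simp only [Ring.lie_def, sub_apply, mul_apply_eq_comp, map_sub, hadj, key, hS',
      hT', map_neg]
    abel

/-- A set `L` of bounded operators is a Lie ideal of `O_C` if it is (the underlying set of) a
Lie ideal of the complex Lie algebra `O_C`: a complex-linear subspace of `O_C` such that
`[A, X] ∈ L` for all `A ∈ O_C` and `X ∈ L`. No topological closedness is required. -/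
def IsLieIdeal (C : Conjugation H) (L : Set (H →L[ℂ] H)) : Prop :=
  ∃ J : LieIdeal ℂ C.orthogonalLieAlgebra,
    L = (Subtype.val : C.orthogonalLieAlgebra → (H →L[ℂ] H)) '' (J : Set C.orthogonalLieAlgebra)

end Conjugation

-- The transpose `T ↦ C T* C` is a complex-linear involution of $B(H)$ whose skew elements form
-- $O_C$. In infinite dimension there are four isometries commuting with $C$, with orthogonal ranges
-- that add up to $H$, so $B(H)$ becomes a 4 × 4 matrix ring over itself, compatibly with the
-- transpose.
--
-- The ideal attached to a Lie ideal $L$ consists of the coefficients whose off-diagonal skew matrix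
-- units all lie in $L$ (`exists_twoSidedIdeal_of_skew_lieIdeal`). Off-diagonal entries are handled
-- by brackets alone. Diagonal entries need two facts about an ideal $J$ of $B(H)$: a skew element
-- of $J$ is a sum of commutators $[a, b]$ with $a ∈ J$, and a skew element that is central modulo
-- $J$ lies in $J$.
--
-- Both facts come from one observation. A selfadjoint $P$ has a real matrix in some orthonormal
-- basis, so $CPC$ is unitarily equivalent to $P$ (`exists_conj_eq_mul_mul`). If moreover $CPC =
-- -P$, then $2P = P - UPU^{-1}$, which is a commutator. General skew operators reduce to
-- selfadjoint ones because ideals of $B(H)$ are closed under adjoints, by polar decomposition.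

universe u

/-! ### Lie ideals of skew elements in a matrix ring with involution -/

section SkewLieIdeals

variable {R : Type*} [Ring R] [StarRing R]

/-- The matrix unit `e i j` with coefficient `a`, for a family `S` of isometries. -/
def isometryUnit {n : ℕ} (S : Fin n → R) (i j : Fin n) (a : R) : R := S i * a * star (S j)

/-- The skew part of `isometryUnit S i j a`. -/
def skewUnit {n : ℕ} (S : Fin n → R) (i j : Fin n) (a : R) : R :=
  isometryUnit S i j a - isometryUnit S j i (star a)

variable {n : ℕ} {S : Fin n → R}

theorem star_isometryUnit (i j : Fin n) (a : R) :
    star (isometryUnit S i j a) = isometryUnit S j i (star a) := by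
  simp [isometryUnit, mul_assoc]

theorem star_skewUnit (i j : Fin n) (a : R) : star (skewUnit S i j a) = -skewUnit S i j a := by
  simp [skewUnit, star_isometryUnit]

theorem isometryUnit_add (i j : Fin n) (a b : R) :
    isometryUnit S i j (a + b) = isometryUnit S i j a + isometryUnit S i j b := by
  simp [isometryUnit, mul_add, add_mul]

theorem isometryUnit_neg (i j : Fin n) (a : R) :
    isometryUnit S i j (-a) = -isometryUnit S i j a := by
  simp [isometryUnit]

theorem skewUnit_add (i j : Fin n) (a b : R) :
    skewUnit S i j (a + b) = skewUnit S i j a + skewUnit S i j b := by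
  simp only [skewUnit, star_add, isometryUnit_add]; abel

theorem skewUnit_neg (i j : Fin n) (a : R) : skewUnit S i j (-a) = -skewUnit S i j a := by
  simp only [skewUnit, star_neg, isometryUnit_neg]; abel

theorem isometryUnit_mul_isometryUnit (hS : ∀ i j, star (S i) * S j = if i = j then 1 else 0)
    (i j k l : Fin n) (a b : R) :
    isometryUnit S i j a * isometryUnit S k l b =
      if j = k then isometryUnit S i l (a * b) else 0 := by
  have : isometryUnit S i j a * isometryUnit S k l b =
      S i * a * (star (S j) * S k) * b * star (S l) := by
    simp only [isometryUnit, mul_assoc]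
  rw [this, hS]
  split_ifs <;> simp [isometryUnit, mul_assoc]

theorem isometryUnit_mul_mul_isometryUnit (i j k l : Fin n) (a b X : R) :
    isometryUnit S i j a * X * isometryUnit S k l b =
      isometryUnit S i l (a * (star (S j) * X * S k) * b) := by
  simp only [isometryUnit, mul_assoc]

theorem entry_isometryUnit_mul (hS : ∀ i j, star (S i) * S j = if i = j then 1 else 0)
    (i j k l : Fin n) (a X : R) :
    star (S k) * (isometryUnit S i j a * X) * S l =
      if k = i then a * (star (S j) * X * S l) else 0 := by
  have : star (S k) * (isometryUnit S i j a * X) * S l =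
      (star (S k) * S i) * (a * (star (S j) * X * S l)) := by
    simp only [isometryUnit, mul_assoc]
  rw [this, hS]
  split_ifs <;> simp

theorem entry_mul_isometryUnit (hS : ∀ i j, star (S i) * S j = if i = j then 1 else 0)
    (i j k l : Fin n) (a X : R) :
    star (S k) * (X * isometryUnit S i j a) * S l =
      if j = l then (star (S k) * X * S i) * a else 0 := by
  have : star (S k) * (X * isometryUnit S i j a) * S l =
      (star (S k) * X * S i) * a * (star (S j) * S l) := by
    simp only [isometryUnit, mul_assoc]
  rw [this, hS]
  split_ifs <;> simp

theorem skewUnit_lie_skewUnit (hS : ∀ i j, star (S i) * S j = if i = j then 1 else 0)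
    {i j k : Fin n} (hij : i ≠ j) (hjk : j ≠ k) (hik : i ≠ k) (a b : R) :
    skewUnit S i j a * skewUnit S j k b - skewUnit S j k b * skewUnit S i j a =
      skewUnit S i k (a * b) := by
  simp [skewUnit, sub_mul, mul_sub, isometryUnit_mul_isometryUnit hS, hij, hij.symm, hjk,
    hjk.symm, hik, hik.symm]

theorem skewUnit_lie_skewUnit_swap (hS : ∀ i j, star (S i) * S j = if i = j then 1 else 0)
    {i j : Fin n} (hij : i ≠ j) (a b : R) :
    skewUnit S i j a * skewUnit S j i b - skewUnit S j i b * skewUnit S i j a =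
      skewUnit S i i (a * b) - skewUnit S j j (b * a) := by
  simp [skewUnit, sub_mul, mul_sub, isometryUnit_mul_isometryUnit hS, hij, hij.symm]
  abel

theorem sum_isometryUnit_entry (hS1 : ∑ i, S i * star (S i) = 1) (X : R) :
    ∑ i, ∑ j, isometryUnit S i j (star (S i) * X * S j) = X := by
  calc _ = (∑ i, S i * star (S i)) * X * (∑ j, S j * star (S j)) := by
        simp only [Finset.sum_mul, Finset.mul_sum, isometryUnit, mul_assoc]
        exact Finset.sum_comm
    _ = X := by simp [hS1]

/-- The double sum meets both $(i, j)$ and $(j, i)$, whence the doubling; this is why the main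
argument requires `hLtwo`. -/
theorem sum_skewUnit_entry (hS1 : ∑ i, S i * star (S i) = 1) {X : R} (hX : star X = -X) :
    ∑ i, ∑ j, skewUnit S i j (star (S i) * X * S j) = X + X := by
  have : ∀ i j, star (star (S i) * X * S j) = -(star (S j) * X * S i) := by
    intro i j; simp [hX, mul_assoc]
  simp only [skewUnit, this, isometryUnit_neg, sub_neg_eq_add, Finset.sum_add_distrib]
  rw [sum_isometryUnit_entry hS1, Finset.sum_comm, sum_isometryUnit_entry hS1]

/-- Lie ideals of the skew elements of a ring with involution that contains a `4 × 4` system of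
matrix units given by isometries: if in every ideal the skew elements are sums of commutators, and
modulo every ideal no nonzero skew element is central, then each such Lie ideal consists of the
skew elements of a two-sided ideal. -/
theorem exists_twoSidedIdeal_of_skew_lieIdeal {S : Fin 4 → R}
    (hS : ∀ i j, star (S i) * S j = if i = j then 1 else 0)
    (hS1 : ∑ i, S i * star (S i) = 1)
    (hcomm : ∀ (J : TwoSidedIdeal R) (x : R), x ∈ J → star x = -x →
      x ∈ AddSubgroup.closure {y | ∃ a ∈ J, ∃ b, y = a * b - b * a})
    (hcent : ∀ (J : TwoSidedIdeal R) (x : R), star x = -x → (∀ b, x * b - b * x ∈ J) → x ∈ J)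
    (L : AddSubgroup R) (hLskew : ∀ x ∈ L, star x = -x)
    (hLlie : ∀ A, star A = -A → ∀ X ∈ L, A * X - X * A ∈ L)
    (hLtwo : ∀ x, x + x ∈ L → x ∈ L) :
    ∃ J : TwoSidedIdeal R, ∀ x, x ∈ L ↔ x ∈ J ∧ star x = -x := by
  have hLlie' : ∀ A, star A = -A → ∀ X ∈ L, X * A - A * X ∈ L := fun A hA X hX => by
    have := L.neg_mem (hLlie A hA X hX)
    rwa [neg_sub] at this
  have third : ∀ i j k : Fin 4, ∃ m, m ≠ i ∧ m ≠ j ∧ m ≠ k := by decide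
  have move_right : ∀ {i j k : Fin 4} {a : R} (b : R), i ≠ j → j ≠ k → i ≠ k →
      skewUnit S i j a ∈ L → skewUnit S i k (a * b) ∈ L := fun b hij hjk hik h => by
    rw [← skewUnit_lie_skewUnit hS hij hjk hik]
    exact hLlie' _ (star_skewUnit _ _ _) _ h
  have move_left : ∀ {i j k : Fin 4} {a : R} (b : R), i ≠ j → j ≠ k → i ≠ k →
      skewUnit S j k a ∈ L → skewUnit S i k (b * a) ∈ L := fun b hij hjk hik h => by
    rw [← skewUnit_lie_skewUnit hS hij hjk hik]
    exact hLlie _ (star_skewUnit _ _ _) _ h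
  -- The route is $(i,j) → (i,m) → (k,m) → (k,l)$; choosing $m$ outside $\{i, j, k\}$ takes a fourth
  -- index.
  have move : ∀ {i j : Fin 4} {a : R}, i ≠ j → skewUnit S i j a ∈ L →
      ∀ k l, k ≠ l → skewUnit S k l a ∈ L := by
    intro i j a hij h k l hkl
    obtain ⟨m, hmi, hmj, hmk⟩ := third i j k
    have h1 : skewUnit S i m a ∈ L := by
      simpa using move_right 1 hij hmj.symm hmi.symm h
    have h2 : skewUnit S k m a ∈ L := by
      by_cases hki : k = i
      · rwa [hki]
      · simpa using move_left 1 hki hmi.symm hmk.symm h1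
    by_cases hlm : l = m
    · rwa [hlm]
    · simpa using move_right 1 hmk.symm (Ne.symm hlm) hkl h2
  let J : TwoSidedIdeal R := TwoSidedIdeal.mk' {a | ∀ i j, i ≠ j → skewUnit S i j a ∈ L}
    (fun i j _ => by simp [skewUnit, isometryUnit])
    (fun ha hb i j hij => by rw [skewUnit_add]; exact L.add_mem (ha i j hij) (hb i j hij))
    (fun ha i j hij => by rw [skewUnit_neg]; exact L.neg_mem (ha i j hij))
    (fun {x y} hy i j hij => by
      obtain ⟨m, hmi, hmj, -⟩ := third i j j
      exact move_left x hmi.symm hmj hij (hy m j hmj))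
    (fun {x y} hx i j hij => by
      obtain ⟨m, hmi, hmj, -⟩ := third i j j
      exact move_right y hmi.symm hmj hij (hx i m hmi.symm))
  have mem_J : ∀ a, a ∈ J ↔ ∀ i j, i ≠ j → skewUnit S i j a ∈ L := fun a =>
    TwoSidedIdeal.mem_mk' ..
  -- Two rotation blocks give a skew invertible element. The projections $S_i S_i^*$ are symmetric,
  -- so they cannot be bracketed with $L$, but $S_i s S_i^*$ is skew.
  obtain ⟨s, hs, hss⟩ : ∃ s : R, star s = -s ∧ s * s = -1 := by
    refine ⟨skewUnit S 0 1 1 + skewUnit S 2 3 1, ?_, ?_⟩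
    · rw [star_add, star_skewUnit, star_skewUnit]; abel
    · calc _ = -∑ i, isometryUnit S i i 1 := by
            simp [skewUnit, sub_mul, mul_sub, add_mul, mul_add, isometryUnit_mul_isometryUnit hS,
              Fin.sum_univ_four]
            abel
        _ = -1 := by simp [isometryUnit, hS1]
  have offDiag : ∀ X ∈ L, ∀ i j, i ≠ j → star (S i) * X * S j ∈ J := by
    intro X hX i j hij
    have hE : ∀ k, star (isometryUnit S k k s) = -isometryUnit S k k s := fun k => by
      rw [star_isometryUnit, hs, isometryUnit_neg]
    -- The double bracket $[[E_i, X], E_j]$ keeps only the $(i,j)$ and $(j,i)$ entries of $X$; the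
    -- factors $s$ are removed below by $s^2 = -1$.
    have h1 := hLlie' _ (hE j) _ (hLlie _ (hE i) _ hX)
    have h2 : (isometryUnit S i i s * X - X * isometryUnit S i i s) * isometryUnit S j j s -
        isometryUnit S j j s * (isometryUnit S i i s * X - X * isometryUnit S i i s) =
        skewUnit S i j (s * (star (S i) * X * S j) * s) := by
      have e1 : isometryUnit S i i s * isometryUnit S j j s = 0 := by
        simp [isometryUnit_mul_isometryUnit hS, hij]
      have e2 : isometryUnit S j j s * isometryUnit S i i s = 0 := by
        simp [isometryUnit_mul_isometryUnit hS, hij.symm]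
      rw [sub_mul, mul_sub, mul_assoc X, e1, ← mul_assoc, ← mul_assoc, e2,
        isometryUnit_mul_mul_isometryUnit, isometryUnit_mul_mul_isometryUnit, skewUnit]
      have : star (s * (star (S i) * X * S j) * s) = -(s * (star (S j) * X * S i) * s) := by
        simp [hs, hLskew X hX, mul_assoc]
      rw [this, isometryUnit_neg]
      simp
    rw [h2] at h1
    have h3 : s * (star (S i) * X * S j) * s ∈ J := (mem_J _).2 (move hij h1)
    have h4 := J.mul_mem_left s _ (J.mul_mem_right _ s h3)
    have h5 : s * (s * (star (S i) * X * S j) * s * s) =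
        (s * s) * (star (S i) * X * S j) * (s * s) := by simp only [mul_assoc]
    rw [h5, hss] at h4
    simpa using h4
  have diag : ∀ X ∈ L, ∀ i, star (S i) * X * S i ∈ J := by
    intro X hX i
    obtain ⟨j, hji, -, -⟩ := third i i i
    -- This is the $(i,j)$ entry of a bracket of $X$ with a skew unit. Taking $b = 1$ gives $X_{ii}
    -- ≡ X_{jj}$, so $X_{ii}$ is central modulo $J$.
    have key : ∀ b, (star (S i) * X * S i) * b - b * (star (S j) * X * S j) ∈ J := fun b => by
      have h := offDiag _ (hLlie' _ (star_skewUnit (S := S) i j b) X hX) i j hji.symm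
      have hexp : ∀ A B : R, star (S i) * (X * (A - B) - (A - B) * X) * S j =
          star (S i) * (X * A) * S j - star (S i) * (X * B) * S j -
            (star (S i) * (A * X) * S j - star (S i) * (B * X) * S j) := by
        intro A B; noncomm_ring
      rw [skewUnit, hexp] at h
      simp only [entry_isometryUnit_mul hS, entry_mul_isometryUnit hS] at h
      simpa [hji, hji.symm] using h
    apply hcent J
    · simp [hLskew X hX, mul_assoc]
    · intro b
      have h1 := J.sub_mem (key b) (J.mul_mem_left b _ (key 1))
      have h2 : star (S i) * X * S i * b - b * (star (S j) * X * S j) -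
          b * (star (S i) * X * S i * 1 - 1 * (star (S j) * X * S j)) =
          star (S i) * X * S i * b - b * (star (S i) * X * S i) := by noncomm_ring
      rwa [h2] at h1
  have skew_diag : ∀ x ∈ J, star x = -x → ∀ i, skewUnit S i i x ∈ L := by
    intro x hx hxs i
    obtain ⟨j, hji, -, -⟩ := third i i i
    have key : ∀ a ∈ J, ∀ b, skewUnit S j j (a * b) - skewUnit S i i (b * a) ∈ L :=
      fun a ha b => by
        rw [← skewUnit_lie_skewUnit_swap hS hji]
        exact hLlie' _ (star_skewUnit _ _ _) _ ((mem_J a).1 ha j i hji)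
    refine AddSubgroup.closure_induction (p := fun x _ => skewUnit S i i x ∈ L) ?_ ?_ ?_ ?_
      (hcomm J x hx hxs)
    · rintro _ ⟨a, ha, b, rfl⟩
      -- The pairs $(a, b)$ and $(ab, 1)$ give the same $(j,j)$ term, so the difference leaves $ab -
      -- ba$ at $(i,i)$.
      have h := L.sub_mem (key a ha b) (key _ (J.mul_mem_right a b ha) 1)
      simp only [mul_one, one_mul, sub_sub_sub_cancel_left] at h
      rwa [sub_eq_add_neg, skewUnit_add, skewUnit_neg, ← sub_eq_add_neg]
    · simp [skewUnit, isometryUnit]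
    · intro a b _ _ ha hb
      rw [skewUnit_add]; exact L.add_mem ha hb
    · intro a _ ha
      rw [skewUnit_neg]; exact L.neg_mem ha
  refine ⟨J, fun x => ⟨fun hx => ⟨?_, hLskew x hx⟩, fun ⟨hx, hxs⟩ => hLtwo x ?_⟩⟩
  · rw [← sum_isometryUnit_entry hS1 x]
    refine sum_mem fun i _ => sum_mem fun j _ => ?_
    refine J.mul_mem_right _ _ (J.mul_mem_left _ _ ?_)
    by_cases hij : i = j
    · rw [hij]; exact diag x hx j
    · exact offDiag x hx i j hij
  · rw [← sum_skewUnit_entry hS1 hxs]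
    refine sum_mem fun i _ => sum_mem fun j _ => ?_
    have hent : star (S i) * x * S j ∈ J := J.mul_mem_right _ _ (J.mul_mem_left _ _ hx)
    by_cases hij : i = j
    · subst hij
      exact skew_diag _ hent (by simp [hxs, mul_assoc]) i
    · exact (mem_J _).1 hent i j hij

end SkewLieIdeals

/-! ### Polar decomposition and real forms of a Hilbert space -/

section HilbertSpace

variable {H : Type u} [NormedAddCommGroup H] [InnerProductSpace ℂ H] [CompleteSpace H]

/-- A weak form of Douglas' factorization lemma. -/
theorem ContinuousLinearMap.exists_eq_mul_of_norm_eq (A B : H →L[ℂ] H)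
    (h : ∀ x, ‖A x‖ = ‖B x‖) : ∃ U : H →L[ℂ] H, A = U * B := by
  let K : Submodule ℂ H := (LinearMap.range (B : H →ₗ[ℂ] H)).topologicalClosure
  have hK : IsClosed (K : Set H) := Submodule.isClosed_topologicalClosure _
  have : CompleteSpace K := hK.completeSpace_coe
  have hBK : ∀ x, B x ∈ K := fun x => Submodule.le_topologicalClosure _ ⟨x, rfl⟩
  let e : H →ₗ[ℂ] K := (B : H →ₗ[ℂ] H).codRestrict K hBK
  have hdense : DenseRange e := by
    rw [DenseRange, Subtype.dense_iff]
    intro x hx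
    have : (Subtype.val '' Set.range e) = (LinearMap.range (B : H →ₗ[ℂ] H) : Set H) := by
      ext y
      simp [e]
    exact this ▸ hx
  have hnorm : ∃ c : ℝ, ∀ x, ‖(A : H →ₗ[ℂ] H) x‖ ≤ c * ‖e x‖ :=
    ⟨1, fun x => by simpa [e] using (h x).le⟩
  -- The map $Bx ↦ Ax$ is isometric on the range of $B$; it extends to the closure, and by zero to
  -- the orthogonal complement.
  refine ⟨((A : H →ₗ[ℂ] H).extendOfNorm e).comp K.orthogonalProjectionOnto, ?_⟩
  ext x
  have h1 : K.orthogonalProjectionOnto (B x) = e x :=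
    Submodule.orthogonalProjectionOnto_mem_subspace_eq_self (K := K) (e x)
  simp only [ContinuousLinearMap.mul_def, ContinuousLinearMap.comp_apply]
  rw [h1, LinearMap.extendOfNorm_eq hdense hnorm]
  rfl

/-- The adjoint of a bounded operator lies in the two-sided ideal generated by the operator. -/
theorem ContinuousLinearMap.exists_star_eq_mul_mul (A : H →L[ℂ] H) :
    ∃ U V : H →L[ℂ] H, star A = U * A * V := by
  have hP : star (CFC.abs A) = CFC.abs A := (CFC.abs_nonneg A).isSelfAdjoint.star_eq
  have hnorm : ∀ x, ‖A x‖ = ‖CFC.abs A x‖ := by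
    intro x
    have key : ∀ T : H →L[ℂ] H, ⟪(star T * T) x, x⟫_ℂ = (‖T x‖ : ℂ) ^ 2 := fun T => by
      rw [mul_apply_eq_comp, ContinuousLinearMap.star_eq_adjoint,
        ContinuousLinearMap.adjoint_inner_left, inner_self_eq_norm_sq_to_K]
      rfl
    have h1 := key A
    have h2 := key (CFC.abs A)
    rw [hP, CFC.abs_mul_abs, h1] at h2
    have h3 : ‖A x‖ ^ 2 = ‖CFC.abs A x‖ ^ 2 := by exact_mod_cast h2
    exact (sq_eq_sq₀ (norm_nonneg _) (norm_nonneg _)).1 h3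
  -- From $A = U|A|$ and $|A| = VA$ follows $A^* = |A|U^* = VAU^*$.
  obtain ⟨U, hU⟩ := ContinuousLinearMap.exists_eq_mul_of_norm_eq _ _ hnorm
  obtain ⟨V, hV⟩ := ContinuousLinearMap.exists_eq_mul_of_norm_eq _ _ fun x => (hnorm x).symm
  refine ⟨V, star U, ?_⟩
  rw [← hV]
  nth_rewrite 1 [hU]
  rw [star_mul, hP]

theorem TwoSidedIdeal.star_mem_of_continuousLinearMap (J : TwoSidedIdeal (H →L[ℂ] H))
    {A : H →L[ℂ] H} (hA : A ∈ J) : star A ∈ J := by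
  obtain ⟨U, V, h⟩ := ContinuousLinearMap.exists_star_eq_mul_mul A
  rw [h]
  exact J.mul_mem_right _ _ (J.mul_mem_left _ _ hA)

/-- A closed real subspace on which the inner product is real and whose orthogonal complement is
trivial contains a Hilbert basis of the complex space. -/
theorem exists_hilbertBasis_mem_of_inner_im_eq_zero (M : Set H) (hMclosed : IsClosed M)
    (hM0 : (0 : H) ∈ M) (hMadd : ∀ x ∈ M, ∀ y ∈ M, x + y ∈ M)
    (hMsmul : ∀ (c : ℝ), ∀ x ∈ M, (c : ℂ) • x ∈ M)
    (hMreal : ∀ x ∈ M, ∀ y ∈ M, (⟪x, y⟫_ℂ).im = 0)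
    (hMtotal : ∀ x, (∀ m ∈ M, ⟪m, x⟫_ℂ = 0) → x = 0) :
    ∃ (ι : Type u) (b : HilbertBasis ι ℂ H), ∀ i, b i ∈ M := by
  let _ : InnerProductSpace ℝ H := InnerProductSpace.rclikeToReal ℂ H
  let V : Submodule ℝ H :=
    { carrier := M
      zero_mem' := hM0
      add_mem' := fun hx hy => hMadd _ hx _ hy
      smul_mem' := fun c x hx => by
        have := hMsmul c x hx
        rwa [Complex.coe_smul] at this }
  have : CompleteSpace V := (show IsClosed (V : Set H) from hMclosed).completeSpace_coe
  obtain ⟨w, b, -⟩ := exists_hilbertBasis ℝ V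
  have hinner : ∀ x y : V, ⟪(x : H), (y : H)⟫_ℂ = ((⟪x, y⟫_ℝ : ℝ) : ℂ) := by
    intro x y
    apply Complex.ext
    · rfl
    · simpa using hMreal x x.2 y y.2
  have hon : Orthonormal ℂ (fun i => (b i : H)) := by
    classical
    rw [orthonormal_iff_ite]
    intro i j
    rw [hinner, orthonormal_iff_ite.1 b.orthonormal i j]
    split_ifs <;> simp
  refine ⟨w, HilbertBasis.mkOfOrthogonalEqBot hon ?_, fun i => ?_⟩
  · rw [Submodule.eq_bot_iff]
    intro x hx
    have hbx : ∀ i, ⟪(b i : H), x⟫_ℂ = 0 := fun i =>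
      (Submodule.mem_orthogonal _ _).1 hx _ (Submodule.subset_span ⟨i, rfl⟩)
    refine hMtotal x fun m hm => ?_
    have hs := (b.hasSum_repr ⟨m, hm⟩).mapL V.subtypeL
    have hs' := hs.mapL ((innerSL ℂ x).restrictScalars ℝ)
    have h0 : ∀ i, ((innerSL ℂ x).restrictScalars ℝ) (V.subtypeL (b.repr ⟨m, hm⟩ i • b i)) = 0 := by
      intro i
      have : ⟪x, (b i : H)⟫_ℂ = 0 := inner_eq_zero_symm.1 (hbx i)
      rw [map_smul, map_smul]
      simp [this]
    simp only [h0] at hs'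
    have := hs'.unique hasSum_zero
    exact inner_eq_zero_symm.1 this
  · simp

/-- Every bounded selfadjoint operator has a real matrix with respect to some Hilbert basis. -/
theorem IsSelfAdjoint.exists_hilbertBasis_inner_im_eq_zero {P : H →L[ℂ] H}
    (hP : IsSelfAdjoint P) :
    ∃ (ι : Type u) (b : HilbertBasis ι ℂ H), ∀ i j, (⟪b i, P (b j)⟫_ℂ).im = 0 := by
  have hsymm : ∀ (n : ℕ) x y, ⟪(P ^ n) x, y⟫_ℂ = ⟪x, (P ^ n) y⟫_ℂ := fun n x y => by
    rw [← ContinuousLinearMap.adjoint_inner_right, ← ContinuousLinearMap.star_eq_adjoint,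
      (hP.pow n).star_eq]
  have im_symm : ∀ x y : H, (⟪x, y⟫_ℂ).im = 0 → (⟪y, x⟫_ℂ).im = 0 := fun x y h => by
    rw [← inner_conj_symm, Complex.conj_im, h, neg_zero]
  obtain ⟨M, hM⟩ := zorn_subset
    {s : Set H | (∀ x ∈ s, ∀ y ∈ s, (⟪x, y⟫_ℂ).im = 0) ∧ ∀ x ∈ s, P x ∈ s} (by
      intro c hc hchain
      refine ⟨⋃₀ c, ⟨?_, ?_⟩, fun s hs => Set.subset_sUnion_of_mem hs⟩
      · rintro x ⟨s, hs, hx⟩ y ⟨t, ht, hy⟩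
        rcases hchain.total hs ht with hst | hst
        · exact (hc ht).1 x (hst hx) y hy
        · exact (hc hs).1 x hx y (hst hy)
      · rintro x ⟨s, hs, hx⟩
        exact ⟨s, hs, (hc hs).2 x hx⟩)
  obtain ⟨⟨hreal, hinv⟩, hmax⟩ := hM
  have hinvn : ∀ (n : ℕ), ∀ x ∈ M, (P ^ n) x ∈ M := by
    intro n
    induction n with
    | zero => intro x hx; simpa using hx
    | succ n ih => intro x hx; rw [pow_succ]; exact ih _ (hinv x hx)
  -- The orbit of $v$ can be adjoined because $⟨P^n v, P^k v⟩ = ⟨v, P^{n+k} v⟩$ is real. This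
  -- description makes $M$ a closed real subspace, and a vector orthogonal to $M$ lies in $M$, hence
  -- is orthogonal to itself.
  have mem_M : ∀ v, v ∈ M ↔ ∀ m ∈ M, (⟪m, v⟫_ℂ).im = 0 := by
    refine fun v => ⟨fun hv m hm => hreal m hm v hv, fun hv => ?_⟩
    have hmixed : ∀ m ∈ M, ∀ n : ℕ, (⟪m, (P ^ n) v⟫_ℂ).im = 0 := fun m hm n => by
      rw [← hsymm]; exact hv _ (hinvn n m hm)
    have hself : ∀ n k : ℕ, (⟪(P ^ n) v, (P ^ k) v⟫_ℂ).im = 0 := fun n k => by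
      rw [hsymm, ← mul_apply_eq_comp, ← pow_add]
      have h := inner_conj_symm (𝕜 := ℂ) v ((P ^ (n + k)) v)
      rw [hsymm] at h
      exact Complex.conj_eq_iff_im.1 h
    refine hmax (y := M ∪ Set.range fun n : ℕ => (P ^ n) v) ⟨?_, ?_⟩ Set.subset_union_left
      (Or.inr ⟨0, by simp⟩)
    · rintro x (hx | ⟨n, rfl⟩) y (hy | ⟨k, rfl⟩)
      · exact hreal x hx y hy
      · exact hmixed x hx k
      · exact im_symm _ _ (hmixed y hy n)
      · exact hself n k
    · rintro x (hx | ⟨n, rfl⟩)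
      · exact Or.inl (hinv x hx)
      · exact Or.inr ⟨n + 1, by simp [pow_succ']⟩
  obtain ⟨ι, b, hb⟩ := exists_hilbertBasis_mem_of_inner_im_eq_zero M
    (by
      have : M = ⋂ m ∈ M, {v | (⟪m, v⟫_ℂ).im = 0} := by
        ext v; simpa using mem_M v
      rw [this]
      refine isClosed_biInter fun m _ => isClosed_eq ?_ continuous_const
      exact Complex.continuous_im.comp (continuous_const.inner continuous_id))
    ((mem_M 0).2 (by simp))
    (fun x hx y hy => (mem_M _).2 fun m hm => by
      rw [inner_add_right, Complex.add_im, hreal m hm x hx, hreal m hm y hy, add_zero])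
    (fun c x hx => (mem_M _).2 fun m hm => by
      rw [inner_smul_right, Complex.im_ofReal_mul, hreal m hm x hx, mul_zero])
    hreal
    (fun x hx => by
      have hxM : x ∈ M := (mem_M x).2 fun m hm => by rw [hx m hm]; rfl
      exact inner_self_eq_zero.1 (hx x hxM))
  exact ⟨ι, b, fun i j => hreal _ (hb i) _ (hinv _ (hb j))⟩

end HilbertSpace

/-! ### Operators determined by a Hilbert basis -/

namespace HilbertBasis

variable {H : Type*} [NormedAddCommGroup H] [InnerProductSpace ℂ H] {ι : Type*}

theorem ext_inner_left (b : HilbertBasis ι ℂ H) {x y : H}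
    (h : ∀ i, ⟪b i, x⟫_ℂ = ⟪b i, y⟫_ℂ) : x = y := by
  apply b.repr.injective
  ext i
  rw [b.repr_apply_apply, b.repr_apply_apply, h]

theorem ext_continuousLinearMap {σ : ℂ →+* ℂ} (b : HilbertBasis ι ℂ H) {f g : H →SL[σ] H}
    (h : ∀ i, f (b i) = g (b i)) : f = g :=
  ContinuousLinearMap.ext_on (s := Set.range b)
    (Submodule.dense_iff_topologicalClosure_eq_top.2 b.dense_span)
    (by rintro _ ⟨i, rfl⟩; exact h i)

/-- The isometry that maps a Hilbert basis into itself along an injection of the index set. -/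
noncomputable def reindexIsometry [CompleteSpace H] (b : HilbertBasis ι ℂ H) (σ : ι → ι)
    (hσ : σ.Injective) : H →ₗᵢ[ℂ] H :=
  (b.orthonormal.comp σ hσ).orthogonalFamily.linearIsometry.comp b.repr.toLinearIsometry

theorem reindexIsometry_apply_self [CompleteSpace H] (b : HilbertBasis ι ℂ H) (σ : ι → ι)
    (hσ : σ.Injective) (i : ι) : b.reindexIsometry σ hσ (b i) = b (σ i) := by
  classical
  have h : b.reindexIsometry σ hσ (b i) =
      (b.orthonormal.comp σ hσ).orthogonalFamily.linearIsometry (b.repr (b i)) := rfl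
  rw [h, b.repr_self, OrthogonalFamily.linearIsometry_apply_single]
  simp

end HilbertBasis

/-! ### The transpose, real bases and unitary equivalence -/

namespace Conjugation

section Transpose

variable {H : Type*} [NormedAddCommGroup H] [InnerProductSpace ℂ H] (C : Conjugation H)

theorem apply_apply (x : H) : C (C x) = x := C.involutive' x

theorem inner_apply_left (x y : H) : ⟪C x, y⟫_ℂ = ⟪C y, x⟫_ℂ := by
  rw [← C.inner_map_map' y (C x), C.apply_apply]

theorem inner_apply_right (x y : H) : ⟪x, C y⟫_ℂ = ⟪y, C x⟫_ℂ := by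
  rw [← C.inner_map_map' (C y) x, C.apply_apply]

theorem norm_apply (x : H) : ‖C x‖ = ‖x‖ := by
  have h := C.inner_map_map' x x
  rw [inner_self_eq_norm_sq_to_K, inner_self_eq_norm_sq_to_K] at h
  have h' : ‖C x‖ ^ 2 = ‖x‖ ^ 2 := by exact_mod_cast h
  exact (sq_eq_sq₀ (norm_nonneg _) (norm_nonneg _)).1 h'

/-- A conjugation as a continuous conjugate-linear map. -/
noncomputable def toContinuousLinearMap : H →L⋆[ℂ] H :=
  C.toMap.mkContinuous 1 fun x => by rw [one_mul]; exact (C.norm_apply x).le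

/-- The operator `C T C`. -/
noncomputable def conj (T : H →L[ℂ] H) : H →L[ℂ] H :=
  C.toContinuousLinearMap.comp (T.comp C.toContinuousLinearMap)

theorem conj_apply (T : H →L[ℂ] H) (x : H) : C.conj T x = C (T (C x)) := rfl

theorem conj_conj (T : H →L[ℂ] H) : C.conj (C.conj T) = T := by
  ext x; simp [conj_apply, apply_apply]

theorem conj_neg (T : H →L[ℂ] H) : C.conj (-T) = -C.conj T := by
  ext x; simp [conj_apply]

variable [CompleteSpace H]

theorem star_conj (T : H →L[ℂ] H) : star (C.conj T) = C.conj (star T) := by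
  rw [ContinuousLinearMap.star_eq_adjoint, eq_comm, ContinuousLinearMap.eq_adjoint_iff]
  intro x y
  rw [conj_apply, conj_apply, inner_apply_left, ContinuousLinearMap.star_eq_adjoint,
    ContinuousLinearMap.adjoint_inner_right, inner_apply_right]

/-- The transpose `T ↦ C T* C` with respect to a conjugation `C`, as a (complex-linear) involution
of the ring of bounded operators. -/
@[reducible]
noncomputable def transposeStarRing : StarRing (H →L[ℂ] H) where
  star T := C.conj (star T)
  star_involutive T := by
    show C.conj (star (C.conj (star T))) = T
    rw [star_conj, star_star, conj_conj]
  star_mul S T := by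
    show C.conj (star (S * T)) = C.conj (star T) * C.conj (star S)
    ext x; simp [conj_apply, apply_apply]
  star_add S T := by
    show C.conj (star (S + T)) = C.conj (star S) + C.conj (star T)
    ext x; simp [conj_apply]

theorem mem_orthogonalLieAlgebra_iff (T : H →L[ℂ] H) :
    T ∈ C.orthogonalLieAlgebra ↔ C.conj (star T) = -T := by
  have h : T ∈ C.orthogonalLieAlgebra ↔ C.conj T = -star T := by
    rw [ContinuousLinearMap.ext_iff]; rfl
  rw [h]
  constructor
  · intro hT
    rw [← neg_eq_iff_eq_neg, ← C.conj_neg, ← hT, conj_conj]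
  · intro hT
    rw [← neg_eq_iff_eq_neg, ← C.conj_neg, ← hT, conj_conj]

end Transpose

variable {H : Type u} [NormedAddCommGroup H] [InnerProductSpace ℂ H] [CompleteSpace H]
  (C : Conjugation H)

theorem exists_hilbertBasis_apply_eq :
    ∃ (ι : Type u) (b : HilbertBasis ι ℂ H), ∀ i, C (b i) = b i := by
  have hreal : ∀ x ∈ {x : H | C x = x}, ∀ y ∈ {x : H | C x = x}, (⟪x, y⟫_ℂ).im = 0 := by
    intro x hx y hy
    have h := C.inner_map_map' x y
    rw [Set.mem_ofPred_eq] at hx hy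
    rw [hx, hy, ← inner_conj_symm y x] at h
    exact Complex.conj_eq_iff_im.1 h.symm
  refine exists_hilbertBasis_mem_of_inner_im_eq_zero {x | C x = x}
    (isClosed_eq C.toContinuousLinearMap.continuous continuous_id) ?_ ?_ ?_ hreal ?_
  · simp
  · intro x hx y hy
    rw [Set.mem_ofPred_eq] at *
    rw [map_add, hx, hy]
  · intro c x hx
    rw [Set.mem_ofPred_eq] at *
    rw [map_smulₛₗ, hx, Complex.conj_ofReal]
  -- Both $x + Cx$ and $i(x - Cx)$ are fixed by $C$; orthogonality of $x$ to both forces $⟨x, x⟩ =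
  -- 0$.
  · intro x hx
    have h1 := hx (x + C x) (by simp [apply_apply, add_comm])
    have h2 := hx (Complex.I • (x - C x)) (by simp [apply_apply, smul_sub, neg_add_eq_sub])
    rw [inner_smul_left, mul_eq_zero] at h2
    have h2' := h2.resolve_left (by simp)
    rw [inner_add_left] at h1
    rw [inner_sub_left] at h2'
    have : ⟪x, x⟫_ℂ = 0 := by linear_combination (h1 + h2') / 2
    exact inner_self_eq_zero.1 this

/-- The transpose of a selfadjoint operator is unitarily equivalent to that operator. -/
theorem exists_conj_eq_mul_mul {P : H →L[ℂ] H} (hP : IsSelfAdjoint P) :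
    ∃ U V : H →L[ℂ] H, U * V = 1 ∧ V * U = 1 ∧ C.conj P = U * P * V := by
  obtain ⟨ι, b, hb⟩ := hP.exists_hilbertBasis_inner_im_eq_zero
  have hon : Orthonormal ℂ fun i => C (b i) := by
    classical
    rw [orthonormal_iff_ite]
    intro i j
    rw [C.inner_map_map', orthonormal_iff_ite.1 b.orthonormal]
    simp only [eq_comm]
  obtain ⟨c, hc⟩ : ∃ c : HilbertBasis ι ℂ H, ∀ i, c i = C (b i) := by
    refine ⟨HilbertBasis.mkOfOrthogonalEqBot hon ?_, fun i => by
      rw [HilbertBasis.coe_mkOfOrthogonalEqBot]⟩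
    rw [Submodule.eq_bot_iff]
    intro x hx
    have h0 : C x = 0 := b.ext_inner_left fun i => by
      rw [inner_apply_right, inner_zero_right, inner_eq_zero_symm]
      exact (Submodule.mem_orthogonal _ _).1 hx _ (Submodule.subset_span ⟨i, rfl⟩)
    rw [← C.apply_apply x, h0, map_zero]
  let W : H ≃ₗᵢ[ℂ] H := b.repr.trans c.repr.symm
  have hW : ∀ i, W (b i) = C (b i) := fun i => by
    classical
    rw [← hc]
    show c.repr.symm (b.repr (b i)) = c i
    rw [b.repr_self, c.repr_symm_single]
  let U : H →L[ℂ] H := W.toContinuousLinearEquiv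
  let V : H →L[ℂ] H := W.symm.toContinuousLinearEquiv
  have hUV : U * V = 1 := by ext x; simp [U, V]
  have hVU : V * U = 1 := by ext x; simp [U, V]
  -- The matrix of $CPC$ in the basis $Cb$ is the complex conjugate of that of $P$ in $b$, which is
  -- real.
  have key : U * P = C.conj P * U := by
    refine b.ext_continuousLinearMap fun j => c.ext_inner_left fun i => ?_
    have h1 : ⟪c i, (U * P) (b j)⟫_ℂ = ⟪b i, P (b j)⟫_ℂ := by
      rw [hc, ← hW]
      exact W.inner_map_map _ _
    have h2 : ⟪c i, (C.conj P * U) (b j)⟫_ℂ = ⟪P (b j), b i⟫_ℂ := by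
      have : (C.conj P * U) (b j) = C (P (b j)) := by
        show C (P (C (W (b j)))) = _
        rw [hW, apply_apply]
      rw [this, hc, C.inner_map_map']
    rw [h1, h2, ← inner_conj_symm (P (b j))]
    exact (Complex.conj_eq_iff_im.2 (hb i j)).symm
  exact ⟨U, V, hUV, hVU, by rw [key, mul_assoc, hUV, mul_one]⟩

/-- A $C$-fixed basis is infinite, so it splits into four copies of itself; mapping it onto each
copy gives isometries with real matrices. -/
theorem exists_isometries (hH : ¬ FiniteDimensional ℂ H) :
    ∃ S : Fin 4 → (H →L[ℂ] H), (∀ i, C.conj (S i) = S i) ∧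
      (∀ i j, star (S i) * S j = if i = j then 1 else 0) ∧ ∑ i, S i * star (S i) = 1 := by
  obtain ⟨ι, b, hb⟩ := C.exists_hilbertBasis_apply_eq
  have hι : Infinite ι := by
    by_contra hfin
    rw [not_infinite_iff_finite] at hfin
    have := Fintype.ofFinite ι
    exact hH (Module.Basis.finiteDimensional_of_finite b.toOrthonormalBasis.toBasis)
  obtain ⟨e⟩ : Nonempty (ι × Fin 4 ≃ ι) := by
    rw [← Cardinal.eq]
    simp only [Cardinal.mk_prod, Cardinal.mk_fin, Cardinal.lift_natCast, Cardinal.lift_uzero]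
    exact Cardinal.mul_eq_left (Cardinal.aleph0_le_mk ι)
      ((Cardinal.natCast_lt_aleph0).le.trans (Cardinal.aleph0_le_mk ι)) (by norm_num)
  have hinj : ∀ i : Fin 4, Function.Injective fun k => e (k, i) := fun i k l h => by
    simpa using h
  let S : Fin 4 → (H →L[ℂ] H) := fun i => (b.reindexIsometry _ (hinj i)).toContinuousLinearMap
  have hSb : ∀ i k, S i (b k) = b (e (k, i)) := fun i k => b.reindexIsometry_apply_self _ (hinj i) k
  have hS : ∀ i j, star (S i) * S j = if i = j then 1 else 0 := by
    classical
    intro i j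
    refine b.ext_continuousLinearMap fun k => b.ext_inner_left fun l => ?_
    rw [mul_apply_eq_comp, ContinuousLinearMap.star_eq_adjoint,
      ContinuousLinearMap.adjoint_inner_right, hSb, hSb, orthonormal_iff_ite.1 b.orthonormal]
    by_cases hij : i = j
    · simp [hij, orthonormal_iff_ite.1 b.orthonormal]
    · simp [hij]
  refine ⟨S, fun i => ?_, hS, ?_⟩
  · refine b.ext_continuousLinearMap fun k => ?_
    rw [conj_apply, hb, hSb, hb]
  · refine b.ext_continuousLinearMap fun k => ?_
    obtain ⟨⟨l, j⟩, rfl⟩ := e.surjective k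
    have h : ∀ i, (S i * star (S i)) (b (e (l, j))) = if i = j then b (e (l, j)) else 0 := by
      intro i
      rw [mul_apply_eq_comp, ← hSb, ← mul_apply_eq_comp (star (S i)), hS]
      split_ifs with hij
      · simp [hij]
      · simp
    simp [h]

end Conjugation

/-! ### Commutators modulo ideals, and the correspondence -/

namespace Conjugation

variable {H : Type*} [NormedAddCommGroup H] [InnerProductSpace ℂ H] [CompleteSpace H]
  (C : Conjugation H)

/-- A transpose-skew operator is a combination of selfadjoint ones. -/
theorem exists_selfAdjoint_of_conj_star_eq_neg {x : H →L[ℂ] H} (hx : C.conj (star x) = -x) :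
    IsSelfAdjoint (x + star x) ∧ C.conj (x + star x) = -(x + star x) ∧
      IsSelfAdjoint (Complex.I • (x - star x)) ∧
      C.conj (Complex.I • (x - star x)) = -(Complex.I • (x - star x)) ∧
      x = (1 / 4 : ℂ) • ((x + star x) + (x + star x)) +
        (-Complex.I / 4 : ℂ) • (Complex.I • (x - star x) + Complex.I • (x - star x)) := by
  have hx' : C.conj x = -star x := by
    rw [← star_star x, ← star_conj, hx, star_neg, star_star]
  refine ⟨IsSelfAdjoint.add_star_self x, ?_, ?_, ?_, ?_⟩
  · have : C.conj (x + star x) = C.conj x + C.conj (star x) := by ext y; simp [conj_apply]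
    rw [this, hx, hx']; abel
  · rw [IsSelfAdjoint, star_smul, star_sub, star_star, Complex.star_def, Complex.conj_I, neg_smul,
      ← smul_neg, neg_sub]
  · have : C.conj (Complex.I • (x - star x)) = -(Complex.I • (C.conj x - C.conj (star x))) := by
      ext y; simp [conj_apply]
    rw [this, hx, hx']
    congr 2
    abel
  · rw [← smul_add, smul_smul]
    have : -Complex.I / 4 * Complex.I = 1 / 4 := by
      linear_combination (-1 / 4 : ℂ) * Complex.I_mul_I
    rw [this]
    module

theorem exists_add_self_eq_sub {P : H →L[ℂ] H} (hP : IsSelfAdjoint P) (hCP : C.conj P = -P) :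
    ∃ U V : H →L[ℂ] H, U * V = 1 ∧ V * U = 1 ∧ P + P = P - U * P * V := by
  obtain ⟨U, V, hUV, hVU, h⟩ := C.exists_conj_eq_mul_mul hP
  exact ⟨U, V, hUV, hVU, by rw [← h, hCP, sub_neg_eq_add]⟩

theorem _root_.TwoSidedIdeal.smul_mem_of_algebra {R : Type*} [Ring R] [Algebra ℂ R]
    (J : TwoSidedIdeal R) (c : ℂ) {x : R} (hx : x ∈ J) : c • x ∈ J := by
  rw [← smul_one_mul]
  exact J.mul_mem_left _ _ hx

theorem mem_closure_commutators (J : TwoSidedIdeal (H →L[ℂ] H)) {x : H →L[ℂ] H} (hxJ : x ∈ J)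
    (hx : C.conj (star x) = -x) :
    x ∈ AddSubgroup.closure {y | ∃ a ∈ J, ∃ b, y = a * b - b * a} := by
  have key : ∀ (c : ℂ) (P : H →L[ℂ] H), P ∈ J → IsSelfAdjoint P → C.conj P = -P →
      c • (P + P) ∈ AddSubgroup.closure {y | ∃ a ∈ J, ∃ b, y = a * b - b * a} := by
    intro c P hPJ hP hCP
    obtain ⟨U, V, hUV, hVU, h⟩ := C.exists_add_self_eq_sub hP hCP
    -- Since $VU = 1$, $P - UPV = [PV, U]$, with $PV ∈ J$.
    refine AddSubgroup.subset_closure ⟨c • (P * V),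
      J.smul_mem_of_algebra c (J.mul_mem_right _ _ hPJ), U, ?_⟩
    rw [h, smul_mul_assoc, mul_smul_comm, mul_assoc P, hVU, mul_one, smul_sub, mul_assoc]
  have hsJ := J.star_mem_of_continuousLinearMap hxJ
  obtain ⟨h1, h2, h3, h4, h5⟩ := C.exists_selfAdjoint_of_conj_star_eq_neg hx
  rw [h5]
  exact add_mem (key _ _ (J.add_mem hxJ hsJ) h1 h2)
    (key _ _ (J.smul_mem_of_algebra _ (J.sub_mem hxJ hsJ)) h3 h4)

theorem mem_of_forall_commutator_mem (J : TwoSidedIdeal (H →L[ℂ] H)) {x : H →L[ℂ] H}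
    (hx : C.conj (star x) = -x) (hcomm : ∀ b, x * b - b * x ∈ J) : x ∈ J := by
  have key : ∀ (c : ℂ) (P : H →L[ℂ] H), (∀ b, P * b - b * P ∈ J) → IsSelfAdjoint P →
      C.conj P = -P → c • (P + P) ∈ J := by
    intro c P hPJ hP hCP
    obtain ⟨U, V, hUV, hVU, h⟩ := C.exists_add_self_eq_sub hP hCP
    refine J.smul_mem_of_algebra c ?_
    -- Here the same difference is read as $[P, U]V$, using $UV = 1$.
    have h' : P + P = (P * U - U * P) * V := by
      rw [h, sub_mul, mul_assoc P, hUV, mul_one]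
    rw [h']
    exact J.mul_mem_right _ _ (hPJ U)
  have hstar : ∀ b, star x * b - b * star x ∈ J := fun b => by
    have h := J.star_mem_of_continuousLinearMap (J.neg_mem (hcomm (star b)))
    rwa [neg_sub, star_sub, star_mul, star_mul, star_star] at h
  obtain ⟨h1, h2, h3, h4, h5⟩ := C.exists_selfAdjoint_of_conj_star_eq_neg hx
  rw [h5]
  refine J.add_mem (key _ _ (fun b => ?_) h1 h2) (key _ _ (fun b => ?_) h3 h4)
  · have := J.add_mem (hcomm b) (hstar b)
    convert this using 1
    noncomm_ring
  · have := J.smul_mem_of_algebra Complex.I (J.sub_mem (hcomm b) (hstar b))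
    convert this using 1
    rw [smul_mul_assoc, mul_smul_comm, ← smul_sub]
    congr 1
    noncomm_ring

theorem isLieIdeal_inter (I : TwoSidedIdeal (H →L[ℂ] H)) :
    C.IsLieIdeal ((I : Set (H →L[ℂ] H)) ∩ (C.orthogonalLieAlgebra : Set (H →L[ℂ] H))) := by
  refine ⟨{ carrier := {x | (x : H →L[ℂ] H) ∈ I}
            zero_mem' := I.zero_mem
            add_mem' := fun ha hb => I.add_mem ha hb
            smul_mem' := fun c x hx => I.smul_mem_of_algebra c hx
            lie_mem := fun {x m} hm =>
              I.sub_mem (I.mul_mem_left _ _ hm) (I.mul_mem_right _ _ hm) }, ?_⟩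
  ext T
  constructor
  · rintro ⟨hT, hT'⟩
    exact ⟨⟨T, hT'⟩, hT, rfl⟩
  · rintro ⟨x, hx, rfl⟩
    exact ⟨hx, x.2⟩

theorem IsLieIdeal.exists_twoSidedIdeal (hH : ¬ FiniteDimensional ℂ H) {L : Set (H →L[ℂ] H)}
    (hL : C.IsLieIdeal L) :
    ∃ I : TwoSidedIdeal (H →L[ℂ] H),
      L = (I : Set (H →L[ℂ] H)) ∩ (C.orthogonalLieAlgebra : Set (H →L[ℂ] H)) := by
  obtain ⟨J, rfl⟩ := hL
  obtain ⟨S, hSC, hS, hS1⟩ := C.exists_isometries hH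
  have hSC' : ∀ i, C.conj (star (S i)) = star (S i) := fun i => by rw [← star_conj, hSC]
  let N : Submodule ℂ (H →L[ℂ] H) :=
    (J : Submodule ℂ C.orthogonalLieAlgebra).map C.orthogonalLieAlgebra.toSubmodule.subtype
  have mem_N : ∀ T, T ∈ N ↔ ∃ x ∈ J, (x : H →L[ℂ] H) = T := fun T => Submodule.mem_map
  -- The involution is the transpose rather than the adjoint, so that skew means membership in
  -- $O_C$; on the $C$-real $S_i$ the two agree.
  obtain ⟨I, hI⟩ := @exists_twoSidedIdeal_of_skew_lieIdeal (H →L[ℂ] H) _ C.transposeStarRing S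
    (fun i j => by
      show C.conj (star (S i)) * S j = _
      rw [hSC', hS])
    (by
      show ∑ i, S i * C.conj (star (S i)) = 1
      simp only [hSC', hS1])
    (fun J x hxJ hx => C.mem_closure_commutators J hxJ hx)
    (fun J x hx h => C.mem_of_forall_commutator_mem J hx h)
    N.toAddSubgroup
    (fun T hT => by
      obtain ⟨x, -, rfl⟩ := (mem_N T).1 hT
      exact (C.mem_orthogonalLieAlgebra_iff _).1 x.2)
    (fun A hA T hT => by
      obtain ⟨x, hx, rfl⟩ := (mem_N T).1 hT
      have hA' : A ∈ C.orthogonalLieAlgebra := (C.mem_orthogonalLieAlgebra_iff _).2 hA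
      exact (mem_N _).2 ⟨⁅(⟨A, hA'⟩ : C.orthogonalLieAlgebra), x⁆, J.lie_mem hx, rfl⟩)
    (fun T hT => by
      have h := N.smul_mem (1 / 2 : ℂ) hT
      have h2 : (1 / 2 : ℂ) • (T + T) = T := by module
      rwa [h2] at h)
  refine ⟨I, Set.ext fun T => ?_⟩
  have h := hI T
  constructor
  · rintro hT
    have h' := h.1 ((mem_N T).2 hT)
    exact ⟨h'.1, (C.mem_orthogonalLieAlgebra_iff _).2 h'.2⟩
  · rintro ⟨hT, hT'⟩
    exact (mem_N T).1 (h.2 ⟨hT, (C.mem_orthogonalLieAlgebra_iff _).1 hT'⟩)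

end Conjugation

theorem theorem1p2 {H : Type*} [NormedAddCommGroup H] [InnerProductSpace ℂ H] [CompleteSpace H]
    [TopologicalSpace.SeparableSpace H] (hH : ¬ FiniteDimensional ℂ H)
    (C : Conjugation H) (L : Set (H →L[ℂ] H))
    (hL : L ⊆ (C.orthogonalLieAlgebra : Set (H →L[ℂ] H))) :
    C.IsLieIdeal L ↔
      ∃ I : TwoSidedIdeal (H →L[ℂ] H),
        L = (I : Set (H →L[ℂ] H)) ∩ (C.orthogonalLieAlgebra : Set (H →L[ℂ] H)) := by
  refine ⟨fun h => Conjugation.IsLieIdeal.exists_twoSidedIdeal C hH h, ?_⟩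
  rintro ⟨I, rfl⟩
  exact C.isLieIdeal_inter I
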